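/- **Guarded METAs.** A guarded multi-energy timed automaton (guarded META) consists of finite sets of actions, of locations, of atomic propositions, of clocks $X$ and of energy variables $\mathcal E$; an initial location $\ell_0$; a nonempty set of private locations and a nonempty set of final locations, the two being disjoint; a labelling of the locations by sets of atomic propositions; for each location $\ell$ an invariant $I(\ell)$ and an energy rate $\phi(\ell):\mathcal E\to\mathbb Z$; and a finite set of edges $(\ell,g,a,R,U,\ell')$ with guard $g$, action $a$ (possibly silent), reset set $R\subseteq X$ and energy update $U:\mathcal E\to\mathbb Z$. Guards and invariants are finite conjunctions of inequalities $v\bowtie c$ with $v\in X\cup\mathcal E$, ${\bowtie}\in\{<,\le,\ge,>\}$, $c\in\mathbb Z$. Final locations have no outgoing edges, and the zero valuations satisfy $I(\ell_0)$. The automaton is *discrete* if all rates are $0$, so that energy variables change only along edges. **Runs.** A state is a triple $(\ell,w,v)$ of a location, a clock valuation $w\in\mathbb R_{\ge0}^X$ and an energy valuation $v\in\mathbb R_{\ge 0}^{\mathcal E}$ that together satisfy $I(\ell)$. A run starts in the state $(\ell_0,0,0)$ and is a finite sequence of $n\ge 0$ steps. The step number $i$ ($0\le i<n$) first lets a real time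 $d_i\ge0$ elapse (clocks grow at rate $1$, energies at the rates of the location, and one stays in the set of states throughout), and then takes an edge whose guard holds, resets the clocks in $R$ to $0$ and adds $U$ to the energy valuation; the result must again be a state. Let $v_0=0$, and let $v_{i+1}$ be the energy valuation after step $i$. A run is *private* if it ends in a final location and visits a private location; it is *public* if it ends in a final location and visits no private location. **Discrete energy observation.** For a run $\rho$ of a discrete guarded META and $t\ge 0$, let $\mathrm{EL}(\rho,t)=v_k$, where $k\le n$ is the largest number such that $\sum_{j<k}d_j\le t$. The observation of $\rho$ is the finite sequence $\mathrm{DEO}(\rho)=\big(\mathrm{EL}(\rho,1),\dots,\mathrm{EL}(\rho,K)\big)$ with $K=\big\lceil\sum_{j<n}d_j\big\rceil$. The automaton is *$\exists$-DE-opaque* if some private run and some public run have the same observation; *weakly DE-opaque* if for every private run there is a public run with the same observation; *fully DE-opaque* if it is weakly DE-opaque and for every public run there is a private run with the same observation. **Proposition.** For each $\delta\in\{\exists,\text{weak},\text{full}\}$, the following problem is undecidable: given a discrete guarded META with exactly two energy variables and one clock, is it $\delta$-DE-opaque? -/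

import Mathlib

/-! Guarded multi-energy timed automata (guarded METAs), their dense-time semantics, the
discrete-time observation of energy, and the associated opacity notions.

So that automata can be inputs of algorithms, the finite sets occurring in an automaton are initial
segments of the natural numbers: actions, atomic propositions and locations are numbers, clocks are
`Fin nX` and energy variables are `Fin nE`. -/

/-- The comparison operators `<`, `≤`, `≥`, `>`. -/
inductive Cmp where
  | lt | le | ge | gt

/-- Truth of `a ⋈ b`. -/
def Cmp.Holds : Cmp → ℝ → ℝ → Prop
  | .lt, a, b => a < b
  | .le, a, b => a ≤ b
  | .ge, a, b => b ≤ a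
  | .gt, a, b => b < a

/-- An inequality `v ⋈ c`, where `v` is a clock or an energy variable and `c` is an integer. -/
structure Atom (nX nE : ℕ) where
  var : Fin nX ⊕ Fin nE
  op : Cmp
  const : ℤ

/-- A simple constraint: a finite conjunction of inequalities. -/
abbrev SimpleConstraint (nX nE : ℕ) := List (Atom nX nE)

/-- The satisfaction relation of simple constraints, for a clock valuation `w` and an energy
valuation `v`. -/
def SimpleConstraint.Sat {nX nE : ℕ} (g : SimpleConstraint nX nE)
    (w : Fin nX → ℝ) (v : Fin nE → ℝ) : Prop :=
  ∀ a ∈ g, a.op.Holds (Sum.elim w v a.var) (a.const : ℝ)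

/-- The data attached to a location: whether it is private, whether it is final, its label (a
finite set of atomic propositions, given as a list), its invariant and its energy rates. -/
structure LocData (nX nE : ℕ) where
  isPriv : Bool
  isFinal : Bool
  label : List ℕ
  inv : SimpleConstraint nX nE
  rate : Fin nE → ℤ

/-- An edge: source, guard, action (`none` is the silent action), set of clocks to be reset (as a
characteristic function), energy update (offsets) and target. -/
structure Edge (nX nE : ℕ) where
  src : ℕ
  guard : SimpleConstraint nX nE
  act : Option ℕ
  reset : Fin nX → Bool
  update : Fin nE → ℤ
  tgt : ℕ

/-- The data of a guarded META with `nX` clocks and `nE` energy variables. The actions are the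
numbers below `numActions`, the atomic propositions those below `numProps`, and the locations are
the positions in the list `locs`. The requirements on these data are in
`GuardedMETA.WellFormed`. -/
structure GuardedMETA (nX nE : ℕ) where
  numActions : ℕ
  numProps : ℕ
  locs : List (LocData nX nE)
  init : ℕ
  edges : List (Edge nX nE)

section Encoding

/-- Comparison operators as the elements of `Fin 4`. -/
def Cmp.equivFin : Cmp ≃ Fin 4 where
  toFun
    | .lt => 0
    | .le => 1
    | .ge => 2
    | .gt => 3
  invFun
    | 0 => .lt
    | 1 => .le
    | 2 => .ge
    | 3 => .gt
  left_inv c := by cases c <;> rfl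
  right_inv i := by fin_cases i <;> rfl

instance : Primcodable Cmp := Primcodable.ofEquiv (Fin 4) Cmp.equivFin

/-- Atoms as tuples. -/
def Atom.equivProd (nX nE : ℕ) : Atom nX nE ≃ (Fin nX ⊕ Fin nE) × Cmp × ℤ where
  toFun a := (a.var, a.op, a.const)
  invFun p := ⟨p.1, p.2.1, p.2.2⟩
  left_inv _ := rfl
  right_inv _ := rfl

instance (nX nE : ℕ) : Primcodable (Atom nX nE) := Primcodable.ofEquiv _ (Atom.equivProd nX nE)

/-- Location data as tuples. -/
def LocData.equivProd (nX nE : ℕ) :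
    LocData nX nE ≃ Bool × Bool × List ℕ × List (Atom nX nE) × (Fin nE → ℤ) where
  toFun l := (l.isPriv, l.isFinal, l.label, l.inv, l.rate)
  invFun p := ⟨p.1, p.2.1, p.2.2.1, p.2.2.2.1, p.2.2.2.2⟩
  left_inv _ := rfl
  right_inv _ := rfl

instance (nX nE : ℕ) : Primcodable (LocData nX nE) :=
  Primcodable.ofEquiv _ (LocData.equivProd nX nE)

/-- Edges as tuples. -/
def Edge.equivProd (nX nE : ℕ) :
    Edge nX nE ≃ ℕ × List (Atom nX nE) × Option ℕ × (Fin nX → Bool) × (Fin nE → ℤ) × ℕ where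
  toFun e := (e.src, e.guard, e.act, e.reset, e.update, e.tgt)
  invFun p := ⟨p.1, p.2.1, p.2.2.1, p.2.2.2.1, p.2.2.2.2.1, p.2.2.2.2.2⟩
  left_inv _ := rfl
  right_inv _ := rfl

instance (nX nE : ℕ) : Primcodable (Edge nX nE) := Primcodable.ofEquiv _ (Edge.equivProd nX nE)

/-- Guarded METAs as tuples. -/
def GuardedMETA.equivProd (nX nE : ℕ) :
    GuardedMETA nX nE ≃ ℕ × ℕ × List (LocData nX nE) × ℕ × List (Edge nX nE) where
  toFun A := (A.numActions, A.numProps, A.locs, A.init, A.edges)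
  invFun p := ⟨p.1, p.2.1, p.2.2.1, p.2.2.2.1, p.2.2.2.2⟩
  left_inv _ := rfl
  right_inv _ := rfl

instance (nX nE : ℕ) : Primcodable (GuardedMETA nX nE) :=
  Primcodable.ofEquiv _ (GuardedMETA.equivProd nX nE)

end Encoding

namespace GuardedMETA

variable {nX nE : ℕ}

/-- `l` is a private location. -/
def IsPriv (A : GuardedMETA nX nE) (l : ℕ) : Prop := ∃ L, A.locs[l]? = some L ∧ L.isPriv = true

/-- `l` is a final location. -/
def IsFinal (A : GuardedMETA nX nE) (l : ℕ) : Prop := ∃ L, A.locs[l]? = some L ∧ L.isFinal = true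

/-- The data `A` form a guarded META: the initial location and the sources and targets of edges are
locations, labels and actions are taken from the given sets, there is a private location and a
final location, no location is both, final locations have no outgoing edges, and the zero
valuations satisfy the invariant of the initial location. -/
structure WellFormed (A : GuardedMETA nX nE) : Prop where
  init_lt : A.init < A.locs.length
  label_lt : ∀ L ∈ A.locs, ∀ p ∈ L.label, p < A.numProps
  src_lt : ∀ e ∈ A.edges, e.src < A.locs.length
  tgt_lt : ∀ e ∈ A.edges, e.tgt < A.locs.length
  act_lt : ∀ e ∈ A.edges, ∀ a ∈ e.act, a < A.numActions
  exists_priv : ∃ l, A.IsPriv l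
  exists_final : ∃ l, A.IsFinal l
  not_priv_of_final : ∀ l, A.IsFinal l → ¬ A.IsPriv l
  final_no_edge : ∀ e ∈ A.edges, ¬ A.IsFinal e.src
  init_inv : ∀ L, A.locs[A.init]? = some L → L.inv.Sat (fun _ => 0) (fun _ => 0)

/-- All energy rates are `0`, so that energy variables change only along edges. -/
def IsDiscrete (A : GuardedMETA nX nE) : Prop := ∀ L ∈ A.locs, ∀ η, L.rate η = 0

/-- A location together with a clock valuation and an energy valuation. -/
@[ext] structure Config (nX nE : ℕ) where
  loc : ℕ
  clock : Fin nX → ℝ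
  energy : Fin nE → ℝ

/-- The concrete states: the values are nonnegative and the invariant of the location holds. -/
def IsState (A : GuardedMETA nX nE) (s : Config nX nE) : Prop :=
  (∀ x, 0 ≤ s.clock x) ∧ (∀ η, 0 ≤ s.energy η) ∧
    ∃ L, A.locs[s.loc]? = some L ∧ L.inv.Sat s.clock s.energy

/-- The initial state. -/
def initState (A : GuardedMETA nX nE) : Config nX nE := ⟨A.init, fun _ => 0, fun _ => 0⟩

/-- Letting `d` time units elapse, with energy rates `fl`. -/
def Config.elapse (s : Config nX nE) (fl : Fin nE → ℤ) (d : ℝ) : Config nX nE :=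
  ⟨s.loc, fun x => s.clock x + d, fun η => s.energy η + (fl η : ℝ) * d⟩

/-- Delay transitions. -/
def Delay (A : GuardedMETA nX nE) (s : Config nX nE) (d : ℝ) (s' : Config nX nE) : Prop :=
  0 ≤ d ∧ ∃ L, A.locs[s.loc]? = some L ∧ s' = s.elapse L.rate d ∧
    ∀ d' ∈ Set.Icc 0 d, A.IsState (s.elapse L.rate d')

/-- Discrete transitions. -/
def Fire (A : GuardedMETA nX nE) (s : Config nX nE) (e : Edge nX nE) (s' : Config nX nE) : Prop :=
  e ∈ A.edges ∧ A.IsState s ∧ A.IsState s' ∧ s.loc = e.src ∧ s'.loc = e.tgt ∧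
    e.guard.Sat s.clock s.energy ∧
    (∀ x, s'.clock x = if e.reset x = true then 0 else s.clock x) ∧
    (∀ η, s'.energy η = s.energy η + (e.update η : ℝ))

/-- A delay followed by a discrete transition. -/
def Step (A : GuardedMETA nX nE) (s : Config nX nE) (d : ℝ) (e : Edge nX nE)
    (s' : Config nX nE) : Prop :=
  ∃ s'', A.Delay s d s'' ∧ A.Fire s'' e s'

/-- One step of a run: the delay, the edge, and the state reached. -/
structure RunStep (nX nE : ℕ) where
  delay : ℝ
  edge : Edge nX nE
  target : Config nX nE

/-- The sequence of steps `ρ` is a path of the transition system from the state `s`. -/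
inductive IsPath (A : GuardedMETA nX nE) : Config nX nE → List (RunStep nX nE) → Prop
  | nil {s} : A.IsState s → IsPath A s []
  | cons {s d e s' ρ} : A.Step s d e s' → IsPath A s' ρ → IsPath A s (⟨d, e, s'⟩ :: ρ)

/-- `ρ` is (the sequence of steps of) a run, from the initial state. -/
def IsRun (A : GuardedMETA nX nE) (ρ : List (RunStep nX nE)) : Prop := A.IsPath A.initState ρ

/-- The states that belong to a run, in order. -/
def states (A : GuardedMETA nX nE) (ρ : List (RunStep nX nE)) : List (Config nX nE) :=
  A.initState :: ρ.map RunStep.target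

/-- The last state of a run. -/
def lastState (A : GuardedMETA nX nE) (ρ : List (RunStep nX nE)) : Config nX nE :=
  (A.states ρ).getLast (List.cons_ne_nil _ _)

/-- The duration of a sequence of steps. -/
def duration (ρ : List (RunStep nX nE)) : ℝ := (ρ.map RunStep.delay).sum

/-- Private runs: they end in a final location and visit a private location. -/
def IsPrivateRun (A : GuardedMETA nX nE) (ρ : List (RunStep nX nE)) : Prop :=
  A.IsRun ρ ∧ A.IsFinal (A.lastState ρ).loc ∧ ∃ s ∈ A.states ρ, A.IsPriv s.loc

/-- Public runs: they end in a final location and visit no private location. -/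
def IsPublicRun (A : GuardedMETA nX nE) (ρ : List (RunStep nX nE)) : Prop :=
  A.IsRun ρ ∧ A.IsFinal (A.lastState ρ).loc ∧ ∀ s ∈ A.states ρ, ¬ A.IsPriv s.loc

open Classical in
/-- The energy level at time `t ≥ 0` of a run of a discrete guarded META: the energy valuation
after the largest number `k` of steps that are completed at time `t`, i.e. whose delays sum up to
at most `t` (the zero valuation if `k = 0`). -/
noncomputable def energyLevel (A : GuardedMETA nX nE) (ρ : List (RunStep nX nE)) (t : ℝ) :
    Fin nE → ℝ :=
  (A.lastState (ρ.take (Nat.findGreatest (fun k => duration (ρ.take k) ≤ t) ρ.length))).energy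

/-- The discrete energy observation of a run: its energy levels at the times `1, …, k`, where `k`
is the duration rounded up. -/
noncomputable def DEO (A : GuardedMETA nX nE) (ρ : List (RunStep nX nE)) : List (Fin nE → ℝ) :=
  (List.range ⌈duration ρ⌉₊).map fun i => A.energyLevel ρ ((i : ℝ) + 1)

end GuardedMETA

/-- The three variants of opacity. -/
inductive OpacityKind where
  | exist | weak | full

/-- Discrete-energy opacity, in its three variants. -/
def GuardedMETA.DEOpaque {nX nE : ℕ} (A : GuardedMETA nX nE) : OpacityKind → Prop
  | .exist => ∃ ρ ρ', A.IsPrivateRun ρ ∧ A.IsPublicRun ρ' ∧ A.DEO ρ = A.DEO ρ'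
  | .weak => ∀ ρ, A.IsPrivateRun ρ → ∃ ρ', A.IsPublicRun ρ' ∧ A.DEO ρ = A.DEO ρ'
  | .full => (∀ ρ, A.IsPrivateRun ρ → ∃ ρ', A.IsPublicRun ρ' ∧ A.DEO ρ = A.DEO ρ') ∧
      ∀ ρ', A.IsPublicRun ρ' → ∃ ρ, A.IsPrivateRun ρ ∧ A.DEO ρ = A.DEO ρ'

/-- The problem `P`, with the elements of `C` as instances, is decidable: some partial recursive
function halts on all instances in `C` and answers correctly whether `P` holds (what it does on
inputs outside `C` is irrelevant). -/
def DecidableOn {α : Type} [Primcodable α] (C : Set α) (P : α → Prop) : Prop :=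
  ∃ f : α →. Bool, Partrec f ∧ ∀ a ∈ C, ∃ b ∈ f a, (b = true ↔ P a)

/-! The halting problem reduces to each of the three opacity problems. Nonnegative energy variables
that change only along edges are the two registers of a Minsky machine: a decrement at zero is
blocked by nonnegativity, and a zero test is a guard.

The automaton built from such a machine has two branches to its final location, one through the
private location, the other simulating the machine without visiting it. Both exits require clock
value `1` and zero energies. As the clock is never reset, every run ending in the final location has
duration `1` and observation `[0]` (`DEO_machineMETA`). A private run always exists, so each kind of
opacity says that a public run exists, that is, that the machine accepts
(`deOpaque_machineMETA_iff`).

Halting is the projection of a primitive recursive relation (`exists_primrec₂_halting`). To obtain a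
machine for it, programs are treated as relations closed under composition, union and iteration.
They compute all primitive recursive functions (`computes_of_primrec`), guess the projected
argument, and are compressed to two registers by Gödel numbers (`exists_simulates`). Each program is
a regular language of instruction words, and a DFA for that language supplies the control states
(`RegProg.exists_dfa`). -/

/-! ### Register programs

The relations on register contents `ι →₀ ℕ` that are defined by nondeterministic structured
programs over increments, decrements and zero tests. -/

open Finsupp in
/-- The relations between register contents generated by increments, decrements and zero tests
under composition, union and iteration. -/
inductive RegProg {ι : Type} : ((ι →₀ ℕ) → (ι →₀ ℕ) → Prop) → Prop
  | inc (r : ι) : RegProg fun σ σ' => σ' = σ + single r 1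
  | dec (r : ι) : RegProg fun σ σ' => σ = σ' + single r 1
  | zero (r : ι) : RegProg fun σ σ' => σ r = 0 ∧ σ' = σ
  | fail : RegProg fun _ _ => False
  | skip : RegProg fun σ σ' => σ' = σ
  | comp {P Q} : RegProg P → RegProg Q → RegProg (Relation.Comp P Q)
  | union {P Q} : RegProg P → RegProg Q → RegProg fun σ σ' => P σ σ' ∨ Q σ σ'
  | star {P} : RegProg P → RegProg (Relation.ReflTransGen P)

namespace RegProg

open Finsupp Relation

variable {ι : Type} {P Q : (ι →₀ ℕ) → (ι →₀ ℕ) → Prop}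

theorem congr (hP : RegProg P) (h : ∀ σ σ', P σ σ' ↔ Q σ σ') : RegProg Q := by
  have : P = Q := by ext; exact h _ _
  exact this ▸ hP

/-- Increment and decrement are converse to each other, and zero tests are symmetric. Running
programs backwards yields subtraction from addition and division from multiplication. -/
theorem flip (hP : RegProg P) : RegProg (flip P) := by
  induction hP with
  | inc r => exact dec r
  | dec r => exact inc r
  | zero r =>
    refine (zero r).congr fun σ σ' => ⟨?_, ?_⟩ <;> rintro ⟨h, rfl⟩ <;> exact ⟨h, rfl⟩
  | fail => exact fail
  | skip => exact skip.congr fun σ σ' => eq_comm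
  | comp _ _ ihP ihQ =>
    refine (ihQ.comp ihP).congr fun σ σ' => ?_
    simp only [Relation.Comp, _root_.flip, and_comm]
  | union _ _ ihP ihQ => exact ihP.union ihQ
  | star _ ih => exact ih.star.congr fun σ σ' => reflTransGen_swap

theorem add (τ : ι →₀ ℕ) : RegProg fun σ σ' => σ' = σ + τ := by
  induction τ using Finsupp.induction_linear with
  | zero => simpa using skip
  | add f g hf hg =>
    refine (hf.comp hg).congr fun σ σ' => ?_
    simp [Relation.Comp, add_assoc]
  | single a b =>
    induction b with
    | zero => simpa using skip
    | succ n ih =>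
      refine (ih.comp (inc a)).congr fun σ σ' => ?_
      simp [Relation.Comp, add_assoc, ← single_add]

theorem sub (τ : ι →₀ ℕ) : RegProg fun σ σ' => σ = σ' + τ := (add τ).flip

/-- A loop that decrements `x` and adds `τ` each time, until `x` is zero. -/
theorem drain (x : ι) (τ : ι →₀ ℕ) (hτ : τ x = 0) :
    RegProg fun σ σ' => σ' = σ.erase x + σ x • τ := by
  classical
  -- The iteration may stop at any time, but the final zero test keeps only executions that exhaust
  -- `x`. The value `σ.erase x + σ x • τ` is invariant under the loop body.
  refine ((((dec x).comp (add τ)).star).comp (zero x)).congr fun σ σ' => ?_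
  simp only [Relation.Comp]
  constructor
  · rintro ⟨_, h, h0, rfl⟩
    induction h using ReflTransGen.head_induction_on with
    | refl => simp [h0, erase_of_notMem_support]
    | head h _ ih =>
      obtain ⟨ρ, rfl, rfl⟩ := h
      rw [ih]
      ext r
      by_cases hr : r = x
      · subst hr; simp [hτ]
      · simp [erase_ne hr, hτ, add_mul]; ring
  · rintro rfl
    refine ⟨_, ?_, by simp [hτ], rfl⟩
    generalize ha : σ x = a
    induction a generalizing σ with
    | zero => simp [erase_of_notMem_support, ha]; rfl
    | succ n ih =>
      have hs : σ = σ - single x 1 + single x 1 := by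
        ext r
        by_cases hr : r = x
        · subst hr; simp [ha]
        · simp [Ne.symm hr]
      refine .head ⟨σ - single x 1, hs, rfl⟩ ?_
      convert ih (σ - single x 1 + τ) (by simp [ha, hτ]) using 1
      ext r
      by_cases hr : r = x
      · subst hr; simp [hτ]
      · simp [erase_ne hr, Ne.symm hr, add_mul]; ring

theorem clear (x : ι) : RegProg fun σ σ' => σ' = σ.erase x := by
  simpa using drain x 0 rfl

/-- Moves the content of `x` into `y`. -/
theorem move (x y : ι) (h : x ≠ y) :
    RegProg fun σ σ' => σ' = σ.erase x + single y (σ x) := by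
  classical
  simpa using drain x (single y 1) (by simp [h])

end RegProg

/-! ### Primitive recursive functions by register programs -/

namespace RegProg

open Finsupp Relation

/-- `f` can be computed by register programs: for all input registers below `m`, some program adds
the value of `f` to register `m`, provided that the registers from `m` on are zero. -/
def Computes {n : ℕ} (f : List.Vector ℕ n → ℕ) : Prop :=
  ∀ (m : ℕ) (x : Fin n → ℕ), (∀ i, x i < m) →
    ∃ P : (ℕ →₀ ℕ) → (ℕ →₀ ℕ) → Prop, RegProg P ∧ ∀ σ : ℕ →₀ ℕ, (∀ r ≥ m, σ r = 0) →
      ∀ σ', P σ σ' ↔ σ' = σ + single m (f (List.Vector.ofFn fun i => σ (x i)))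

/-- Adds the content of `x` to `y`, using `t` as auxiliary register. -/
theorem copy {ι : Type} (x y t : ι) (hxy : x ≠ y) (hxt : x ≠ t) (hyt : y ≠ t) :
    ∃ P : (ι →₀ ℕ) → (ι →₀ ℕ) → Prop, RegProg P ∧ ∀ σ : ι →₀ ℕ, σ t = 0 →
      ∀ σ', P σ σ' ↔ σ' = σ + single y (σ x) := by
  classical
  -- Draining destroys `x`, so its content goes to `t` and `y` at once and is then restored from
  -- `t`.
  refine ⟨_, (drain x (single t 1 + single y 1) (by simp [hxy, hxt])).comp (move t x hxt.symm),
    fun σ ht σ' => ?_⟩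
  simp only [Relation.Comp, exists_eq_left]
  refine Eq.congr_right ?_
  ext r
  simp only [Finsupp.add_apply, Finsupp.smul_apply, Finsupp.single_apply, Finsupp.erase_apply,
    smul_eq_mul]
  grind

theorem computes_get {n : ℕ} (i : Fin n) : Computes fun v => v.get i := by
  intro m x hx
  obtain ⟨P, hP, h⟩ := copy (x i) m (m + 1) (hx i).ne (by have := hx i; omega) (by omega)
  refine ⟨P, hP, fun σ hσ σ' => ?_⟩
  rw [h σ (hσ _ (by omega))]
  simp

theorem computes_zero : @Computes 0 fun _ => 0 :=
  fun _ _ _ => ⟨_, skip, fun _ _ _ => by simp⟩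

theorem computes_succ : @Computes 1 fun v => Nat.succ v.head := by
  intro m x hx
  obtain ⟨P, hP, h⟩ := computes_get 0 m x hx
  refine ⟨_, hP.comp (inc m), fun σ hσ σ' => ?_⟩
  simp only [Relation.Comp, h σ hσ, exists_eq_left]
  simp [add_assoc, ← single_add, ← List.Vector.get_zero]

theorem clearRange (m k : ℕ) :
    RegProg fun σ σ' : ℕ →₀ ℕ => σ' = σ.filter fun r => ¬ (m < r ∧ r ≤ m + k) := by
  classical
  induction k with
  | zero =>
    refine skip.congr fun σ σ' => Eq.congr_right ?_
    ext r
    rw [Finsupp.filter_apply, if_pos (by omega)]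
  | succ k ih =>
    refine (ih.comp (clear (m + k + 1))).congr fun σ σ' => ?_
    simp only [Relation.Comp, exists_eq_left]
    refine Eq.congr_right ?_
    ext r
    simp only [Finsupp.filter_apply, Finsupp.erase_apply]
    grind

/-- The programs run one after the other. For the program of `g k` the free registers begin at `m +
k`, so earlier results do not violate its requirement of empty registers. -/
theorem computes_all {n k : ℕ} (g : ℕ → List.Vector ℕ n → ℕ) (hg : ∀ i < k, Computes (g i))
    (m : ℕ) (x : Fin n → ℕ) (hx : ∀ i, x i < m) :
    ∃ P : (ℕ →₀ ℕ) → (ℕ →₀ ℕ) → Prop, RegProg P ∧ ∀ σ : ℕ →₀ ℕ, (∀ r ≥ m, σ r = 0) →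
      ∀ σ', P σ σ' ↔
        σ' = σ + ∑ j ∈ Finset.range k, single (m + j) (g j (List.Vector.ofFn fun i => σ (x i))) := by
  induction k with
  | zero => exact ⟨_, skip, fun _ _ _ => by simp⟩
  | succ k ih =>
    obtain ⟨P, hP, h⟩ := ih fun i hi => hg i (by omega)
    obtain ⟨Q, hQ, h'⟩ := hg k (by omega) (m + k) x fun i => by have := hx i; omega
    refine ⟨_, hP.comp hQ, fun σ hσ σ' => ?_⟩
    simp only [Relation.Comp, h σ hσ, exists_eq_left]
    rw [h', Finset.sum_range_succ, add_assoc]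
    · have (i : Fin n) : (∑ j ∈ Finset.range k,
          single (m + j) (g j (List.Vector.ofFn fun i => σ (x i)))) (x i) = 0 := by
        rw [Finsupp.finsetSum_apply]
        exact Finset.sum_eq_zero fun j _ => single_eq_of_ne (by have := hx i; omega)
      simp only [Finsupp.add_apply, this, add_zero]
    · intro r hr
      rw [Finsupp.add_apply, hσ r (by omega), Finsupp.finsetSum_apply, zero_add]
      refine Finset.sum_eq_zero fun j hj => single_eq_of_ne ?_
      have := Finset.mem_range.1 hj
      omega

theorem sum_single_apply (k m : ℕ) (a : ℕ → ℕ) (r : ℕ) :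
    (∑ j ∈ Finset.range k, single (m + j) (a j)) r = if m ≤ r ∧ r < m + k then a (r - m) else 0 := by
  rw [Finsupp.finsetSum_apply]
  split_ifs with h
  · rw [Finset.sum_eq_single (r - m)]
    · rw [show m + (r - m) = r by omega, single_eq_same]
    · intro j _ hj
      exact single_eq_of_ne (by omega)
    · intro h'
      exact absurd (Finset.mem_range.2 (by omega)) h'
  · refine Finset.sum_eq_zero fun j hj => single_eq_of_ne ?_
    have := Finset.mem_range.1 hj
    omega

/-- Register `m` is reserved for the result, registers `m + 1, …, m + n` hold the values of the `g
i`, and `f` writes to `m + 1 + n`. The result is then moved to `m` and the intermediate values are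
erased. -/
theorem computes_comp {k n : ℕ} {f : List.Vector ℕ n → ℕ} {g : Fin n → List.Vector ℕ k → ℕ}
    (hf : Computes f) (hg : ∀ i, Computes (g i)) :
    Computes fun a => f (List.Vector.ofFn fun i => g i a) := by
  classical
  intro m x hx
  obtain ⟨P, hP, h⟩ := computes_all (k := n)
    (fun i => if hi : i < n then g ⟨i, hi⟩ else fun _ => 0)
    (fun i hi => by simpa [hi] using hg ⟨i, hi⟩) (m + 1) x fun i => by have := hx i; omega
  obtain ⟨Q, hQ, h'⟩ := hf (m + 1 + n) (fun i => m + 1 + i) fun i => by omega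
  refine ⟨_, (hP.comp hQ).comp ((move (m + 1 + n) m (by omega)).comp (clearRange m n)),
    fun σ hσ σ' => ?_⟩
  have hσ₁ : ∀ r ≥ m + 1, σ r = 0 := fun r hr => hσ r (by omega)
  simp only [Relation.Comp, h σ hσ₁, exists_eq_left]
  set ρ : ℕ →₀ ℕ := σ + ∑ j ∈ Finset.range n, single (m + 1 + j)
    ((if hi : j < n then g ⟨j, hi⟩ else fun _ => 0) (List.Vector.ofFn fun i => σ (x i))) with hρ
  have hzero : ∀ r ≥ m + 1 + n, ρ r = 0 := by
    intro r hr
    rw [hρ, Finsupp.add_apply, sum_single_apply, hσ r (by omega)]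
    simp [show ¬ (r < m + 1 + n) by omega]
  have key : (fun i : Fin n => ρ (m + 1 + i)) =
      fun i => g i (List.Vector.ofFn fun i => σ (x i)) := by
    funext i
    rw [hρ, Finsupp.add_apply, sum_single_apply, hσ _ (by omega)]
    simp
  simp only [h' ρ hzero, exists_eq_left, key]
  refine Eq.congr_right ?_
  ext r
  have h1 := hzero (m + 1 + n) le_rfl
  have h2 := hσ r
  have h3 : ¬ (m < r ∧ r ≤ m + n) → ρ r = σ r := by
    intro hr
    rw [hρ, Finsupp.add_apply, sum_single_apply, if_neg (by omega), add_zero]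
  simp only [Finsupp.filter_apply, Finsupp.add_apply, Finsupp.erase_apply, Finsupp.single_apply]
  grind

/-- If the loop body is deterministic along an orbit, the only nondeterminism of the iteration is
the number of rounds. -/
theorem star_iff_of_forall {α : Type*} {P : α → α → Prop} {s : ℕ → α}
    (h : ∀ k a, P (s k) a ↔ a = s (k + 1)) (a : α) :
    ReflTransGen P (s 0) a ↔ ∃ k, a = s k := by
  constructor
  · intro ha
    induction ha with
    | refl => exact ⟨0, rfl⟩
    | tail _ hP ih =>
      obtain ⟨k, rfl⟩ := ih
      exact ⟨k + 1, (h k _).1 hP⟩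
  · rintro ⟨k, rfl⟩
    induction k with
    | zero => rfl
    | succ k ih => exact ih.tail ((h k _).2 rfl)

/-- Register `m` holds the current value, `m + 1` counts the rounds and `m + 2` receives the value
of `g`. The number of rounds is guessed. Copying `x 0` to the counter, run backwards, subtracts the
argument from the counter, and the zero test then forces the guess to be right. -/
theorem computes_prec {n : ℕ} {f : List.Vector ℕ n → ℕ} {g : List.Vector ℕ (n + 2) → ℕ}
    (hf : Computes f) (hg : Computes g) :
    Computes fun v : List.Vector ℕ (n + 1) =>
      v.head.rec (f v.tail) fun y IH => g (y ::ᵥ IH ::ᵥ v.tail) := by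
  classical
  intro m x hx
  obtain ⟨F, hF, hF'⟩ := hf m (fun i => x i.succ) fun i => hx _
  obtain ⟨G, hG, hG'⟩ := hg (m + 2) (Fin.cons (m + 1) (Fin.cons m fun i => x i.succ)) <| by
    intro i
    refine Fin.cases (by simp) (fun i => Fin.cases (by simp) (fun i => ?_) i) i
    have := hx i.succ
    simp only [Fin.cons_succ]
    omega
  obtain ⟨C, hC, hC'⟩ := copy (x 0) (m + 1) (m + 2) (by have := hx 0; omega)
    (by have := hx 0; omega) (by omega)
  refine ⟨_, (hF.comp ((hG.comp ((clear m).comp ((move (m + 2) m (by omega)).comp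
    (inc (m + 1))))).star)).comp (hC.flip.comp ((zero (m + 1)).comp (zero (m + 2)))),
    fun σ hσ σ' => ?_⟩
  set v := List.Vector.ofFn fun i : Fin n => σ (x i.succ) with hv
  let a : ℕ → ℕ := fun k => k.rec (f v) fun y IH => g (y ::ᵥ IH ::ᵥ v)
  let s : ℕ → ℕ →₀ ℕ := fun k => σ + single m (a k) + single (m + 1) k
  have hs : F σ = (· = s 0) := by
    ext τ
    simp [hF' σ hσ, s, a, hv]
  have hstep (k : ℕ) (τ : ℕ →₀ ℕ) : Relation.Comp G (Relation.Comp (fun σ σ' => σ' = σ.erase m)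
      (Relation.Comp (fun σ σ' => σ' = σ.erase (m + 2) + single m (σ (m + 2)))
        fun σ σ' => σ' = σ + single (m + 1) 1)) (s k) τ ↔ τ = s (k + 1) := by
    have hzero : ∀ r ≥ m + 2, s k r = 0 := by
      intro r hr
      simp [s, hσ r (by omega), show m ≠ r by omega,
        show m + 1 ≠ r by omega]
    have hin : (List.Vector.ofFn fun i => s k
        ((Fin.cons (m + 1) (Fin.cons m fun i => x i.succ) : Fin (n + 2) → ℕ) i)) =
        k ::ᵥ a k ::ᵥ v := by
      rw [List.Vector.ofFn, List.Vector.ofFn]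
      congr 1
      · simp [s, hσ]
      · congr 1
        · simp [s, hσ]
        · rw [hv]
          congr 1
          ext i
          have := hx i.succ
          simp [s, show m ≠ x i.succ by omega,
            show m + 1 ≠ x i.succ by omega]
    have ha : a (k + 1) = g (k ::ᵥ a k ::ᵥ v) := rfl
    simp only [Relation.Comp, hG' _ hzero, exists_eq_left, hin, ← ha]
    refine Eq.congr_right ?_
    have h0 := hσ m le_rfl
    have h1 := hσ (m + 1) (by omega)
    have h2 := hσ (m + 2) (by omega)
    ext r
    simp only [s, Finsupp.add_apply, Finsupp.erase_apply, Finsupp.single_apply]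
    grind
  have hout : (List.Vector.ofFn fun i => σ (x i)).head.rec
      (f (List.Vector.ofFn fun i => σ (x i)).tail)
      (fun y IH => g (y ::ᵥ IH ::ᵥ (List.Vector.ofFn fun i => σ (x i)).tail)) = a (σ (x 0)) := by
    have : (List.Vector.ofFn fun i => σ (x i)) = σ (x 0) ::ᵥ v := rfl
    rw [this, List.Vector.head_cons, List.Vector.tail_cons]
  beta_reduce
  rw [hout]
  have hx0 := hx 0
  have h1 := hσ (m + 1) (by omega)
  have h2 := hσ (m + 2) (by omega)
  constructor
  · rintro ⟨_, ⟨_, hτ, hstar⟩, _, hc, _, ⟨h1', rfl⟩, h2', rfl⟩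
    rw [hs] at hτ
    subst hτ
    obtain ⟨k, rfl⟩ := (star_iff_of_forall hstep _).1 hstar
    -- The zero test of `m + 2` is there for this: `copy` is specified only for an empty auxiliary
    -- register, here in the state `σ'` from which the reversed copy is read forwards.
    have hc := (hC' σ' h2' _).1 hc
    have hk := DFunLike.congr_fun hc (m + 1)
    have hσx := DFunLike.congr_fun hc (x 0)
    simp only [s, Finsupp.add_apply, Finsupp.single_apply] at hk hσx
    have hkx : k = σ' (x 0) := by grind
    have hxx : σ (x 0) = σ' (x 0) := by grind
    rw [← hkx] at hc hxx
    rw [hxx]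
    exact (add_right_cancel hc).symm
  · rintro rfl
    refine ⟨s (σ (x 0)), ⟨s 0, by rw [hs], (star_iff_of_forall hstep _).2 ⟨_, rfl⟩⟩,
      σ + single m (a (σ (x 0))), ?_, _, ⟨?_, rfl⟩, ?_, rfl⟩
    · refine (hC' _ ?_ _).2 ?_
      · simp [h2]
      · simp [s, show m ≠ x 0 by omega]
    · simp [h1]
    · simp [h2]

theorem computes_of_primrec {n : ℕ} {f : List.Vector ℕ n → ℕ} (hf : Nat.Primrec' f) :
    Computes f := by
  induction hf with
  | zero => exact computes_zero
  | succ => exact computes_succ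
  | get i => exact computes_get i
  | comp g _ _ ihf ihg => exact computes_comp ihf ihg
  | prec _ _ ihf ihg => exact computes_prec ihf ihg

/-- Projections of primitive recursive relations are accepted by register programs that clear all
registers at the end. -/
theorem exists_of_primrec₂ {p : ℕ → ℕ → ℕ} (hp : Primrec₂ p) :
    ∃ P : (ℕ →₀ ℕ) → (ℕ →₀ ℕ) → Prop, RegProg P ∧
      ∀ n σ', P (single 0 n) σ' ↔ σ' = 0 ∧ ∃ k, p n k = 0 := by
  classical
  obtain ⟨P, hP, h⟩ := computes_of_primrec (Nat.Primrec'.prim_iff₂.2 hp) 2 (fun i => i.1)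
    fun i => i.2
  -- The iterated increment guesses the witness `k` in register `1`; the value of `p` in register
  -- `2` is tested for zero.
  refine ⟨_, (inc 1).star.comp ((hP.comp (zero 2)).comp ((clear 0).comp (clear 1))),
    fun n σ' => ?_⟩
  have hstar := star_iff_of_forall (P := fun σ σ' : ℕ →₀ ℕ => σ' = σ + single 1 1)
    (s := fun k => single 0 n + single 1 k) fun k a => by simp [add_assoc, ← single_add]
  simp only [single_zero, add_zero] at hstar
  have hP' (k : ℕ) (τ : ℕ →₀ ℕ) : P (single 0 n + single 1 k) τ ↔
      τ = single 0 n + single 1 k + single 2 (p n k) := by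
    rw [h _ ?_ τ]
    · simp [List.Vector.ofFn]
    · intro r hr
      simp [show 0 ≠ r by omega, show 1 ≠ r by omega]
  constructor
  · rintro ⟨_, h1, _, ⟨_, h2, h3, rfl⟩, _, rfl, rfl⟩
    obtain ⟨k, rfl⟩ := (hstar _).1 h1
    rw [hP'] at h2
    subst h2
    have hk : p n k = 0 := by simpa using h3
    exact ⟨by simp [hk], k, hk⟩
  · rintro ⟨rfl, k, hk⟩
    refine ⟨_, (hstar _).2 ⟨k, rfl⟩, _, ⟨_, (hP' k _).2 rfl, by simp [hk], rfl⟩, _, rfl, ?_⟩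
    simp [hk]

end RegProg

/-! ### Two registers suffice -/

namespace RegProg

open Finsupp Relation

/-- The Gödel number of a register content. -/
noncomputable def godel (σ : ℕ →₀ ℕ) : ℕ := σ.prod fun i a => Nat.nth Nat.Prime i ^ a

theorem godel_add (σ τ : ℕ →₀ ℕ) : godel (σ + τ) = godel σ * godel τ :=
  Finsupp.prod_add_index' (by simp) fun _ _ _ => pow_add _ _ _

theorem godel_single (r a : ℕ) : godel (single r a) = Nat.nth Nat.Prime r ^ a :=
  Finsupp.prod_single_index (pow_zero _)

theorem prime_nth (r : ℕ) : (Nat.nth Nat.Prime r).Prime :=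
  Nat.nth_mem_of_infinite Nat.infinite_setOfPred_prime r

theorem dvd_godel_iff (σ : ℕ →₀ ℕ) (r : ℕ) : Nat.nth Nat.Prime r ∣ godel σ ↔ σ r ≠ 0 := by
  rw [godel, Finsupp.prod, (prime_nth r).prime.dvd_finsetProd_iff]
  constructor
  · rintro ⟨i, hi, h⟩
    have h := (Nat.prime_dvd_prime_iff_eq (prime_nth r) (prime_nth i)).1
      ((prime_nth r).dvd_of_dvd_pow h)
    rw [Nat.nth_injective Nat.infinite_setOfPred_prime h]
    exact Finsupp.mem_support_iff.1 hi
  · intro h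
    exact ⟨r, Finsupp.mem_support_iff.2 h, dvd_pow_self _ h⟩

theorem eq_add_single_of_ne_zero {σ : ℕ →₀ ℕ} {r : ℕ} (h : σ r ≠ 0) :
    ∃ τ, σ = τ + single r 1 := by
  classical
  refine ⟨σ - single r 1, ?_⟩
  ext i
  by_cases hi : i = r
  · subst hi; simp; omega
  · simp [Ne.symm hi]

/-- Multiplication by `p`. -/
theorem mul (p : ℕ) : RegProg fun σ σ' : Fin 2 →₀ ℕ => σ' = single 0 (σ 1 + σ 0 * p) := by
  -- Register `1` need not be empty at the start. Hence the converse relation splits a number as `b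
  -- + a * p` in all possible ways, which serves for division and for testing divisibility.
  refine ((drain 0 (single 1 p) (by simp)).comp (move 1 0 (by simp))).congr fun σ σ' => ?_
  simp only [Relation.Comp, exists_eq_left]
  refine Eq.congr_right ?_
  ext i
  fin_cases i <;> simp

theorem test_eq {ι : Type} (x : ι) (j : ℕ) :
    RegProg fun σ σ' : ι →₀ ℕ => σ x = j ∧ σ' = σ := by
  classical
  refine (((sub (single x j)).comp (zero x)).comp (add (single x j))).congr fun σ σ' => ?_
  constructor
  · rintro ⟨_, ⟨_, rfl, h, rfl⟩, rfl⟩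
    exact ⟨by simp [h], rfl⟩
  · rintro ⟨h, rfl⟩
    have : σ' = σ'.erase x + single x j := by rw [← h, erase_add_single]
    exact ⟨_, ⟨_, this, by simp, rfl⟩, this⟩

theorem test_lt {ι : Type} (x : ι) (p : ℕ) :
    RegProg fun σ σ' : ι →₀ ℕ => (0 < σ x ∧ σ x < p) ∧ σ' = σ := by
  induction p with
  | zero => exact fail.congr fun σ σ' => by simp
  | succ p ih =>
    rcases Nat.eq_zero_or_pos p with rfl | hp
    · exact fail.congr fun σ σ' => by simp; omega
    · refine (ih.union (test_eq x p)).congr fun σ σ' => ?_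
      rw [← or_and_right]
      refine and_congr_left' ?_
      omega

/-- The two-register program `Q` simulates `P` on Gödel numbers. -/
def Simulates (Q : (Fin 2 →₀ ℕ) → (Fin 2 →₀ ℕ) → Prop) (P : (ℕ →₀ ℕ) → (ℕ →₀ ℕ) → Prop) : Prop :=
  ∀ σ τ, Q (single 0 (godel σ)) τ ↔ ∃ σ', P σ σ' ∧ τ = single 0 (godel σ')

/-- Increments and decrements of `r` become multiplication and exact division by the `r`-th prime. A
zero test becomes non-divisibility: division with a remainder strictly between `0` and the prime,
undone afterwards. Started at a Gödel number, a simulation ends only at Gödel numbers, so it passes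
through composition, union and iteration. -/
theorem exists_simulates {P : (ℕ →₀ ℕ) → (ℕ →₀ ℕ) → Prop} (hP : RegProg P) :
    ∃ Q, RegProg Q ∧ Simulates Q P := by
  induction hP with
  | inc r =>
    refine ⟨_, mul (Nat.nth Nat.Prime r), fun σ τ => ?_⟩
    simp [godel_add, godel_single]
  | dec r =>
    refine ⟨_, (mul (Nat.nth Nat.Prime r)).flip.comp (zero 1), fun σ τ => ?_⟩
    have hp := (prime_nth r).pos
    constructor
    · rintro ⟨_, h, h1, rfl⟩
      have h : godel σ = τ 0 * Nat.nth Nat.Prime r := by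
        simpa [h1] using single_injective 0 h
      obtain ⟨σ', rfl⟩ := eq_add_single_of_ne_zero
        ((dvd_godel_iff σ r).1 ⟨_, h.trans (mul_comm _ _)⟩)
      refine ⟨σ', rfl, ?_⟩
      rw [godel_add, godel_single, pow_one] at h
      rw [Nat.eq_of_mul_eq_mul_right hp h]
      ext i
      fin_cases i <;> simp [h1]
    · rintro ⟨σ', rfl, rfl⟩
      exact ⟨_, by simp [_root_.flip, godel_add, godel_single], by simp, rfl⟩
  | zero r =>
    refine ⟨_, ((mul (Nat.nth Nat.Prime r)).flip.comp (test_lt 1 (Nat.nth Nat.Prime r))).comp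
      (mul (Nat.nth Nat.Prime r)), fun σ τ => ?_⟩
    have hdvd := dvd_godel_iff σ r
    constructor
    · rintro ⟨ρ, ⟨_, h, ⟨h1, h2⟩, rfl⟩, rfl⟩
      refine ⟨σ, ⟨?_, rfl⟩, h.symm⟩
      by_contra h0
      have h := single_injective 0 h
      rw [← ne_eq, ← hdvd, h, Nat.dvd_add_left (dvd_mul_left _ _)] at h0
      exact absurd (Nat.le_of_dvd h1 h0) (by omega)
    · rintro ⟨σ', ⟨h, hσ'⟩, rfl⟩
      rw [hσ']
      have hmod : 0 < godel σ % Nat.nth Nat.Prime r := by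
        rw [Nat.pos_iff_ne_zero, ne_eq, ← Nat.dvd_iff_mod_eq_zero, hdvd]
        simpa using h
      have heq : godel σ = godel σ % Nat.nth Nat.Prime r +
          godel σ / Nat.nth Nat.Prime r * Nat.nth Nat.Prime r := by
        rw [mul_comm, Nat.mod_add_div]
      have hval : single 0 (godel σ) = single (0 : Fin 2)
          ((single 0 (godel σ / Nat.nth Nat.Prime r) +
              single 1 (godel σ % Nat.nth Nat.Prime r) : Fin 2 →₀ ℕ) 1 +
            (single 0 (godel σ / Nat.nth Nat.Prime r) +
              single 1 (godel σ % Nat.nth Nat.Prime r) : Fin 2 →₀ ℕ) 0 * Nat.nth Nat.Prime r) := by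
        congr 1
        simpa using heq
      refine ⟨single 0 (godel σ / Nat.nth Nat.Prime r) + single 1 (godel σ % Nat.nth Nat.Prime r),
        ⟨_, hval, ⟨by simpa using hmod, ?_⟩, rfl⟩, hval⟩
      simpa using Nat.mod_lt _ (prime_nth r).pos
  | fail => exact ⟨_, fail, fun σ τ => by simp⟩
  | skip => exact ⟨_, skip, fun σ τ => by simp⟩
  | comp _ _ ihP ihQ =>
    obtain ⟨P', hP', h⟩ := ihP
    obtain ⟨Q', hQ', h'⟩ := ihQ
    refine ⟨_, hP'.comp hQ', fun σ τ => ⟨?_, ?_⟩⟩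
    · rintro ⟨_, h1, h2⟩
      obtain ⟨σ₁, hσ₁, rfl⟩ := (h _ _).1 h1
      obtain ⟨σ₂, hσ₂, rfl⟩ := (h' _ _).1 h2
      exact ⟨σ₂, ⟨σ₁, hσ₁, hσ₂⟩, rfl⟩
    · rintro ⟨σ₂, ⟨σ₁, hσ₁, hσ₂⟩, rfl⟩
      exact ⟨_, (h _ _).2 ⟨σ₁, hσ₁, rfl⟩, (h' _ _).2 ⟨σ₂, hσ₂, rfl⟩⟩
  | union _ _ ihP ihQ =>
    obtain ⟨P', hP', h⟩ := ihP
    obtain ⟨Q', hQ', h'⟩ := ihQ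
    refine ⟨_, hP'.union hQ', fun σ τ => ?_⟩
    rw [h σ τ, h' σ τ, ← exists_or]
    simp only [or_and_right]
  | star _ ih =>
    obtain ⟨P', hP', h⟩ := ih
    refine ⟨_, hP'.star, fun σ τ => ⟨fun hτ => ?_, ?_⟩⟩
    · induction hτ with
      | refl => exact ⟨σ, .refl, rfl⟩
      | tail _ h1 ih =>
        obtain ⟨σ₁, hσ₁, rfl⟩ := ih
        obtain ⟨σ₂, hσ₂, rfl⟩ := (h _ _).1 h1
        exact ⟨σ₂, hσ₁.tail hσ₂, rfl⟩
    · rintro ⟨σ', hσ', rfl⟩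
      induction hσ' with
      | refl => rfl
      | tail _ h1 ih => exact ih.tail ((h _ _).2 ⟨_, h1, rfl⟩)

end RegProg

/-! ### Register programs as finite automata -/

open scoped Computability

/-! ### Closure properties of regular languages via left quotients -/

namespace Language

variable {α : Type*} {L M : Language α}

theorem isRegular_zero : (0 : Language α).IsRegular := by
  refine .of_finite_range_leftQuotient ((Set.finite_singleton 0).subset ?_)
  rintro _ ⟨x, rfl⟩
  rfl

theorem isRegular_one : (1 : Language α).IsRegular := by
  refine .of_finite_range_leftQuotient ((Set.toFinite {1, 0}).subset ?_)
  rintro _ ⟨x, rfl⟩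
  cases x with
  | nil => exact .inl rfl
  | cons a x =>
    right
    ext y
    simp [mem_leftQuotient, mem_one, notMem_zero]

theorem isRegular_singleton (a : α) : ({[a]} : Language α).IsRegular := by
  refine .of_finite_range_leftQuotient ((Set.toFinite {{[a]}, 1, 0}).subset ?_)
  rintro _ ⟨x, rfl⟩
  match x with
  | [] => exact .inl rfl
  | b :: c :: x =>
    right; right
    ext y
    change b :: c :: (x ++ y) = [a] ↔ _
    simp [notMem_zero]
  | [b] =>
    right
    by_cases h : b = a
    · left
      ext y
      change b :: y = [a] ↔ _
      simp [h, mem_one]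
    · right
      ext y
      change b :: y = [a] ↔ _
      simp [h, notMem_zero]

/-- By Myhill–Nerode it suffices to bound the left quotients. A word `x` is either consumed within
the first factor, or split as `u ++ y` with `u ∈ L`. The quotient is therefore determined by one
quotient of `L` and a set of quotients of `M`, leaving finitely many choices. -/
theorem IsRegular.mul (hL : L.IsRegular) (hM : M.IsRegular) : (L * M).IsRegular := by
  refine .of_finite_range_leftQuotient (((hL.finite_range_leftQuotient.prod
    hM.finite_range_leftQuotient.finite_subsets).image
      fun q : Language α × Set (Language α) => q.1 * M + sSup q.2).subset ?_)
  rintro _ ⟨x, rfl⟩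
  refine ⟨(L.leftQuotient x, {N | ∃ u ∈ L, ∃ y, u ++ y = x ∧ N = M.leftQuotient y}),
    ⟨⟨x, rfl⟩, ?_⟩, ?_⟩
  · rintro _ ⟨u, _, y, _, rfl⟩
    exact ⟨y, rfl⟩
  · ext z
    have hs (S : Set (Language α)) : z ∈ sSup S ↔ ∃ N ∈ S, z ∈ N := Set.mem_sUnion
    simp only [mem_add, hs, mem_leftQuotient, mem_mul, Set.mem_ofPred_eq]
    constructor
    · rintro (⟨a, ha, b, hb, rfl⟩ | ⟨_, ⟨u, hu, y, rfl, rfl⟩, hz⟩)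
      · exact ⟨x ++ a, ha, b, hb, by simp⟩
      · exact ⟨u, hu, y ++ z, hz, by simp⟩
    · rintro ⟨a, ha, b, hb, h⟩
      obtain ⟨c, rfl, rfl⟩ | ⟨c, rfl, rfl⟩ := List.append_eq_append_iff.1 h
      · exact .inr ⟨_, ⟨a, ha, c, rfl, rfl⟩, hb⟩
      · exact .inl ⟨c, ha, b, hb, rfl⟩

/-- The cut between `x` and `z` falls between two factors or inside a factor `y ++ a`. -/
theorem append_mem_kstar_iff {x z : List α} : x ++ z ∈ L∗ ↔ (x ∈ L∗ ∧ z ∈ L∗) ∨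
    ∃ u ∈ L∗, ∃ y, u ++ y = x ∧ ∃ a, y ++ a ∈ L ∧ ∃ b ∈ L∗, a ++ b = z := by
  have happ {u v : List α} (hu : u ∈ L∗) (hv : v ∈ L∗) : u ++ v ∈ L∗ := by
    rw [← kstar_mul_kstar]
    exact append_mem_mul hu hv
  have hone {u : List α} (hu : u ∈ L) : u ∈ L∗ := ⟨[u], by simp, by simpa using hu⟩
  constructor
  · rintro ⟨S, h, hS⟩
    induction S generalizing x with
    | nil =>
      obtain ⟨rfl, rfl⟩ := List.append_eq_nil_iff.1 h
      exact .inl ⟨nil_mem_kstar _, nil_mem_kstar _⟩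
    | cons s S ih =>
      rw [List.flatten_cons] at h
      obtain ⟨c, rfl, hz⟩ | ⟨c, rfl, hz⟩ := List.append_eq_append_iff.1 h
      · exact .inr ⟨[], nil_mem_kstar _, x, rfl, c, hS _ (by simp), S.flatten,
          join_mem_kstar fun y hy => hS y (by simp [hy]), hz.symm⟩
      · have hs := hone (hS s (by simp))
        obtain ⟨hc, hz⟩ | ⟨u, hu, y, rfl, a, ha⟩ :=
          ih hz.symm fun y hy => hS y (by simp [hy])
        · exact .inl ⟨happ hs hc, hz⟩
        · exact .inr ⟨s ++ u, happ hs hu, y, by simp, a, ha⟩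
  · rintro (⟨hx, hz⟩ | ⟨u, hu, y, rfl, a, ha, b, hb, rfl⟩)
    · exact happ hx hz
    · simpa using happ hu (happ (hone ha) hb)

/-- As for products: a quotient of `L∗` is determined by whether `x ∈ L∗` and by a set of quotients
of `L`. -/
theorem IsRegular.kstar (hL : L.IsRegular) : L∗.IsRegular := by
  refine .of_finite_range_leftQuotient ((((Set.toFinite {L∗, 0}).prod
    hL.finite_range_leftQuotient.finite_subsets).image
      fun q : Language α × Set (Language α) => q.1 + sSup q.2 * L∗).subset ?_)
  rintro _ ⟨x, rfl⟩
  classical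
  refine ⟨(if x ∈ L∗ then L∗ else 0, {N | ∃ u ∈ L∗, ∃ y, u ++ y = x ∧ N = L.leftQuotient y}),
    ⟨?_, ?_⟩, ?_⟩
  · dsimp only
    split_ifs <;> simp
  · rintro _ ⟨u, _, y, _, rfl⟩
    exact ⟨y, rfl⟩
  · ext z
    have hs (S : Set (Language α)) (z) : z ∈ sSup S ↔ ∃ N ∈ S, z ∈ N := Set.mem_sUnion
    have hi : z ∈ (if x ∈ L∗ then L∗ else 0) ↔ x ∈ L∗ ∧ z ∈ L∗ := by
      split_ifs with h <;> simp [h, notMem_zero]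
    simp only [mem_add, mem_mul, hs, hi, mem_leftQuotient, append_mem_kstar_iff, Set.mem_ofPred_eq]
    refine or_congr_right ⟨?_, ?_⟩
    · rintro ⟨a, ⟨_, ⟨u, hu, y, rfl, rfl⟩, ha⟩, b, hb, rfl⟩
      exact ⟨u, hu, y, rfl, a, ha, b, hb, rfl⟩
    · rintro ⟨u, hu, y, rfl, a, ha, b, hb, rfl⟩
      exact ⟨a, ⟨_, ⟨u, hu, y, rfl, rfl⟩, ha⟩, b, hb, rfl⟩

end Language

/-- Instructions of register machines. -/
inductive RegOp (ι : Type) where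
  | inc (r : ι)
  | dec (r : ι)
  | zero (r : ι)

namespace RegOp

variable {ι : Type}

instance [Finite ι] : Finite (RegOp ι) := by
  refine Finite.of_injective (β := Fin 3 × ι) (fun
    | inc r => (0, r)
    | dec r => (1, r)
    | zero r => (2, r)) ?_
  rintro (r | r | r) (s | s | s) h <;> simp_all

/-- The effect of an instruction. -/
def Rel : RegOp ι → (ι →₀ ℕ) → (ι →₀ ℕ) → Prop
  | inc r, σ, σ' => σ' = σ + Finsupp.single r 1
  | dec r, σ, σ' => σ = σ' + Finsupp.single r 1
  | zero r, σ, σ' => σ r = 0 ∧ σ' = σ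

/-- The effect of a sequence of instructions. -/
def Exec : List (RegOp ι) → (ι →₀ ℕ) → (ι →₀ ℕ) → Prop
  | [], σ, σ' => σ' = σ
  | a :: w, σ, σ' => ∃ τ, a.Rel σ τ ∧ Exec w τ σ'

theorem exec_append (u v : List (RegOp ι)) (σ σ' : ι →₀ ℕ) :
    Exec (u ++ v) σ σ' ↔ ∃ τ, Exec u σ τ ∧ Exec v τ σ' := by
  induction u generalizing σ with
  | nil => simp [Exec]
  | cons a u ih =>
    simp only [List.cons_append, Exec, ih]
    grind

theorem exec_singleton (a : RegOp ι) (σ σ' : ι →₀ ℕ) : Exec [a] σ σ' ↔ a.Rel σ σ' := by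
  simp [Exec]

end RegOp

open RegOp in
/-- Register programs are regular sets of instruction sequences. -/
theorem RegProg.exists_isRegular {ι : Type} {P : (ι →₀ ℕ) → (ι →₀ ℕ) → Prop} (hP : RegProg P) :
    ∃ L : Language (RegOp ι), L.IsRegular ∧ ∀ σ σ', P σ σ' ↔ ∃ w ∈ L, Exec w σ σ' := by
  have atom (a : RegOp ι) : ∃ L : Language (RegOp ι), L.IsRegular ∧
      ∀ σ σ', a.Rel σ σ' ↔ ∃ w ∈ L, Exec w σ σ' := by
    refine ⟨{[a]}, Language.isRegular_singleton a, fun σ σ' => ?_⟩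
    rw [← exec_singleton]
    exact ⟨fun h => ⟨_, rfl, h⟩, by rintro ⟨_, rfl, h⟩; exact h⟩
  induction hP with
  | inc r => exact atom (.inc r)
  | dec r => exact atom (.dec r)
  | zero r => exact atom (.zero r)
  | fail => exact ⟨0, Language.isRegular_zero, fun σ σ' => by simp [Language.notMem_zero]⟩
  | skip => exact ⟨1, Language.isRegular_one, fun σ σ' => by simp [Language.mem_one, Exec]⟩
  | comp _ _ ihP ihQ =>
    obtain ⟨L, hL, h⟩ := ihP
    obtain ⟨M, hM, h'⟩ := ihQ
    refine ⟨L * M, hL.mul hM, fun σ σ' => ?_⟩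
    simp only [Relation.Comp, h, h', Language.mem_mul]
    constructor
    · rintro ⟨τ, ⟨u, hu, hu'⟩, v, hv, hv'⟩
      exact ⟨_, ⟨u, hu, v, hv, rfl⟩, (exec_append _ _ _ _).2 ⟨τ, hu', hv'⟩⟩
    · rintro ⟨_, ⟨u, hu, v, hv, rfl⟩, hw⟩
      obtain ⟨τ, hu', hv'⟩ := (exec_append _ _ _ _).1 hw
      exact ⟨τ, ⟨u, hu, hu'⟩, v, hv, hv'⟩
  | union _ _ ihP ihQ =>
    obtain ⟨L, hL, h⟩ := ihP
    obtain ⟨M, hM, h'⟩ := ihQ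
    refine ⟨L + M, hL.add hM, fun σ σ' => ?_⟩
    simp only [h, h', Language.mem_add, or_and_right, exists_or]
  | star _ ih =>
    obtain ⟨L, hL, h⟩ := ih
    refine ⟨KStar.kstar L, hL.kstar, fun σ σ' => ⟨fun hs => ?_, ?_⟩⟩
    · induction hs using Relation.ReflTransGen.head_induction_on with
      | refl => exact ⟨[], Language.nil_mem_kstar _, rfl⟩
      | head h1 _ ih =>
        obtain ⟨u, hu, hu'⟩ := (h _ _).1 h1
        obtain ⟨_, ⟨S, rfl, hS⟩, hw⟩ := ih
        refine ⟨_, ⟨u :: S, rfl, ?_⟩, (exec_append _ _ _ _).2 ⟨_, hu', hw⟩⟩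
        simpa using ⟨hu, hS⟩
    · rintro ⟨_, ⟨S, rfl, hS⟩, hw⟩
      induction S generalizing σ with
      | nil => rw [show σ' = σ from hw]
      | cons u S ih =>
        obtain ⟨τ, hu, hv⟩ := (exec_append _ _ _ _).1 hw
        exact .head ((h _ _).2 ⟨u, hS u (by simp), hu⟩) (ih _ (fun y hy => hS y (by simp [hy])) hv)

/-! ### Guarded METAs simulating two-register programs -/

open Finsupp in
/-- Projections of primitive recursive relations are accepted by two-register machines, given as
automata over the set of instructions. -/
theorem RegProg.exists_dfa {p : ℕ → ℕ → ℕ} (hp : Primrec₂ p) :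
    ∃ (N : ℕ) (M : DFA (RegOp (Fin 2)) (Fin N)), ∀ n,
      (∃ w ∈ M.accepts, RegOp.Exec w (single 0 (2 ^ n)) 0) ↔ ∃ k, p n k = 0 := by
  obtain ⟨P, hP, h⟩ := exists_of_primrec₂ hp
  obtain ⟨Q, hQ, h'⟩ := exists_simulates hP
  -- The cleared registers have Gödel number `1`; the extra decrement makes the final contents `0`.
  obtain ⟨L, ⟨S, _, M, rfl⟩, hL⟩ := (hQ.comp (dec 0)).exists_isRegular
  refine ⟨_, DFA.reindex (Fintype.equivFin S) M, fun n => ?_⟩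
  have hn : godel (single 0 n) = 2 ^ n := by rw [godel_single, Nat.nth_prime_zero_eq_two]
  have h1 : godel 0 = 1 := by simp [godel]
  rw [DFA.accepts_reindex, ← hL, Relation.Comp, ← hn]
  have h' (σ τ) : Q (single 0 (godel σ)) τ ↔ ∃ σ', P σ σ' ∧ τ = single 0 (godel σ') := h' σ τ
  simp only [h', h, zero_add]
  constructor
  · rintro ⟨_, ⟨_, ⟨rfl, hk⟩, rfl⟩, _⟩
    exact hk
  · exact fun hk => ⟨_, ⟨0, ⟨rfl, hk⟩, rfl⟩, by rw [h1]⟩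

/-- The enabling condition of an instruction. -/
def RegOp.guard : RegOp (Fin 2) → SimpleConstraint 1 2
  | .inc _ => []
  | .dec _ => []
  | .zero r => [⟨.inr r, .le, 0⟩]

/-- The energy update of an instruction. -/
def RegOp.update : RegOp (Fin 2) → Fin 2 → ℤ
  | .inc r => fun i => if i = r then 1 else 0
  | .dec r => fun i => if i = r then -1 else 0
  | .zero _ => fun _ => 0

/-- Decrements need no guard, because no natural number `τ' i` solves the equation when `τ i = 0`.
The guard `≤ 0` of a zero test means equality on natural numbers. -/
theorem RegOp.rel_iff (a : RegOp (Fin 2)) (w : Fin 1 → ℝ) (τ τ' : Fin 2 →₀ ℕ) :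
    a.Rel τ τ' ↔ a.guard.Sat w (fun i => (τ i : ℝ)) ∧
      ∀ i, (τ' i : ℝ) = (τ i : ℝ) + (a.update i : ℝ) := by
  have hZ (i : Fin 2) : (τ' i : ℝ) = (τ i : ℝ) + (a.update i : ℝ) ↔
      (τ' i : ℤ) = τ i + a.update i := by exact_mod_cast Iff.rfl
  simp only [hZ]
  cases a with
  | inc r =>
    simp only [Rel, guard, SimpleConstraint.Sat, update, Finsupp.ext_iff, Finsupp.add_apply,
      Finsupp.single_apply, List.not_mem_nil, false_imp_iff, implies_true, true_and]
    exact forall_congr' fun i => by split_ifs <;> grind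
  | dec r =>
    simp only [Rel, guard, SimpleConstraint.Sat, update, Finsupp.ext_iff, Finsupp.add_apply,
      Finsupp.single_apply, List.not_mem_nil, false_imp_iff, implies_true, true_and]
    exact forall_congr' fun i => by split_ifs <;> grind
  | zero r =>
    simp [Rel, guard, SimpleConstraint.Sat, update, Finsupp.ext_iff, Cmp.Holds]

namespace GuardedMETA

variable {nX nE : ℕ}

/-- The last state of a path from `s`. -/
def pathEnd (s : Config nX nE) (ρ : List (RunStep nX nE)) : Config nX nE :=
  (s :: ρ.map RunStep.target).getLast (List.cons_ne_nil _ _)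

theorem pathEnd_nil (s : Config nX nE) : pathEnd s [] = s := rfl

theorem pathEnd_cons (s : Config nX nE) (x : RunStep nX nE) (ρ : List (RunStep nX nE)) :
    pathEnd s (x :: ρ) = pathEnd x.target ρ := by
  simp [pathEnd]

/-- The observation of a run of duration `1` consists of its last energy valuation. -/
theorem DEO_of_duration_eq_one (A : GuardedMETA nX nE) {ρ : List (RunStep nX nE)}
    (h : duration ρ = 1) : A.DEO ρ = [(A.lastState ρ).energy] := by
  have hlevel : A.energyLevel ρ 1 = (A.lastState ρ).energy := by
    -- All steps are completed at time `1`, including those of delay `0` at the end, so the greatest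
    -- index is the length of the run.
    rw [energyLevel, Nat.findGreatest_eq (by simp [h]), List.take_length]
  simp [DEO, h, hlevel]

/-- An edge with silent action and without resets. -/
def plainEdge (src : ℕ) (guard : SimpleConstraint 1 2) (update : Fin 2 → ℤ) (tgt : ℕ) :
    Edge 1 2 :=
  ⟨src, guard, none, fun _ => false, update, tgt⟩

/-- A location without invariant and with energy rates `0`. -/
def plainLoc (isPriv isFinal : Bool) : LocData 1 2 := ⟨isPriv, isFinal, [], [], fun _ => 0⟩

/-- The constraint that the clock is `1` and the energies are `0`. -/
def exitGuard : SimpleConstraint 1 2 :=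
  [⟨.inl 0, .ge, 1⟩, ⟨.inl 0, .le, 1⟩, ⟨.inr 0, .le, 0⟩, ⟨.inr 1, .le, 0⟩]

theorem exitGuard_sat_iff {w : Fin 1 → ℝ} {v : Fin 2 → ℝ} (hv : ∀ i, 0 ≤ v i) :
    exitGuard.Sat w v ↔ w 0 = 1 ∧ v = 0 := by
  have h0 := hv 0
  have h1 := hv 1
  simp only [exitGuard, SimpleConstraint.Sat, List.mem_cons, List.not_mem_nil, or_false,
    forall_eq_or_imp, forall_eq, Cmp.Holds, Sum.elim_inl, Sum.elim_inr, Int.cast_one,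
    Int.cast_zero, funext_iff, Fin.forall_fin_two, Pi.zero_apply]
  grind

variable {N : ℕ} (M : DFA (RegOp (Fin 2)) (Fin N)) (c : ℕ)

/-- The locations: the initial location `0`, the private location `1`, the final location `2`, and
the states of the automaton from `3` on. -/
def machineLocs (N : ℕ) : List (LocData 1 2) :=
  plainLoc false false :: plainLoc true false :: plainLoc false true ::
    List.replicate N (plainLoc false false)

/-- The edges that do not depend on the input: a private branch, the instructions of the
automaton, and its acceptance. -/
noncomputable def machineEdges : List (Edge 1 2) :=
  plainEdge 0 [] 0 1 :: plainEdge 1 exitGuard 0 2 ::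
    (((Set.toFinite (Set.univ : Set (Fin N × RegOp (Fin 2)))).toFinset.toList.map fun q =>
        plainEdge (3 + q.1) q.2.guard q.2.update (3 + M.step q.1 q.2)) ++
      (Set.toFinite M.accept).toFinset.toList.map fun q => plainEdge (3 + q) exitGuard 0 2)

/-- The guarded META that reaches the final location at time `1`, either through the private
location, or by running the two-register machine `M` with initial register contents `c` and `0`
and final register contents `0`. -/
noncomputable def machineMETA : GuardedMETA 1 2 where
  numActions := 0
  numProps := 0
  locs := machineLocs N
  init := 0
  -- The input enters only through the offset of this edge.
  edges := plainEdge 0 [] (fun i => if i = 0 then (c : ℤ) else 0) (3 + M.start) :: machineEdges M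

theorem mem_edges_machineMETA {e : Edge 1 2} : e ∈ (machineMETA M c).edges ↔
    e = plainEdge 0 [] (fun i => if i = 0 then (c : ℤ) else 0) (3 + M.start) ∨
    e = plainEdge 0 [] 0 1 ∨ e = plainEdge 1 exitGuard 0 2 ∨
    (∃ (q : Fin N) (a : RegOp (Fin 2)),
      e = plainEdge (3 + q) a.guard a.update (3 + M.step q a)) ∨
    ∃ q ∈ M.accept, e = plainEdge (3 + q) exitGuard 0 2 := by
  simp [machineMETA, machineEdges, eq_comm]

theorem getElem?_machineLocs {l : ℕ} {L : LocData 1 2} : (machineLocs N)[l]? = some L ↔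
    l < 3 + N ∧ L = plainLoc (decide (l = 1)) (decide (l = 2)) := by
  rcases l with _ | _ | _ | l
  · simp [machineLocs, eq_comm]
  · simp [machineLocs, eq_comm]; omega
  · simp [machineLocs, eq_comm]; omega
  · simp [machineLocs, List.getElem?_replicate, eq_comm, add_comm 3 N]

theorem isFinal_machineMETA {l : ℕ} : (machineMETA M c).IsFinal l ↔ l = 2 := by
  simp only [IsFinal, machineMETA, getElem?_machineLocs]
  constructor
  · rintro ⟨_, ⟨_, rfl⟩, h⟩
    simpa [plainLoc] using h
  · rintro rfl
    exact ⟨_, ⟨by omega, rfl⟩, rfl⟩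

theorem isPriv_machineMETA {l : ℕ} : (machineMETA M c).IsPriv l ↔ l = 1 := by
  simp only [IsPriv, machineMETA, getElem?_machineLocs]
  constructor
  · rintro ⟨_, ⟨_, rfl⟩, h⟩
    simpa [plainLoc] using h
  · rintro rfl
    exact ⟨_, ⟨by omega, rfl⟩, rfl⟩

theorem isDiscrete_machineMETA : (machineMETA M c).IsDiscrete := by
  intro L hL η
  obtain ⟨l, hl⟩ := List.mem_iff_getElem?.1 hL
  rw [(getElem?_machineLocs.1 hl).2]
  rfl

theorem src_tgt_machineMETA {e : Edge 1 2} (he : e ∈ (machineMETA M c).edges) :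
    e.src < 3 + N ∧ e.tgt < 3 + N ∧ e.src ≠ 2 ∧ e.act = none ∧ ∀ x, e.reset x = false := by
  obtain rfl | rfl | rfl | ⟨q, a, rfl⟩ | ⟨q, _, rfl⟩ := (mem_edges_machineMETA M c).1 he <;>
    refine ⟨?_, ?_, ?_, rfl, fun _ => rfl⟩ <;> simp only [plainEdge] <;> omega

theorem wellFormed_machineMETA : (machineMETA M c).WellFormed := by
  have hlen : (machineMETA M c).locs.length = 3 + N := by
    simp [machineMETA, machineLocs]; omega
  refine ⟨?_, ?_, ?_, ?_, ?_, ⟨1, ?_⟩, ⟨2, ?_⟩, ?_, ?_, ?_⟩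
  · simp [machineMETA, machineLocs]
  · intro L hL
    obtain ⟨l, hl⟩ := List.mem_iff_getElem?.1 hL
    rw [(getElem?_machineLocs.1 hl).2]
    simp [plainLoc]
  · exact fun e he => hlen ▸ (src_tgt_machineMETA M c he).1
  · exact fun e he => hlen ▸ (src_tgt_machineMETA M c he).2.1
  · intro e he
    simp [(src_tgt_machineMETA M c he).2.2.2.1]
  · rw [isPriv_machineMETA]
  · rw [isFinal_machineMETA]
  · intro l
    rw [isFinal_machineMETA, isPriv_machineMETA]
    omega
  · intro e he
    rw [isFinal_machineMETA]
    exact (src_tgt_machineMETA M c he).2.2.1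
  · intro L hL
    rw [(getElem?_machineLocs.1 hL).2]
    simp [plainLoc, SimpleConstraint.Sat]

theorem isState_machineMETA {s : Config 1 2} : (machineMETA M c).IsState s ↔
    (∀ x, 0 ≤ s.clock x) ∧ (∀ η, 0 ≤ s.energy η) ∧ s.loc < 3 + N := by
  simp only [IsState, machineMETA, getElem?_machineLocs]
  refine and_congr_right' (and_congr_right' ⟨?_, fun h => ⟨_, ⟨h, rfl⟩, ?_⟩⟩)
  · rintro ⟨L, ⟨h, _⟩, _⟩
    exact h
  · simp [plainLoc, SimpleConstraint.Sat]

/-- Without invariants, rates and resets, a delay only advances the clock, and its intermediate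
states are admissible as soon as its start is. -/
theorem step_machineMETA {s s' : Config 1 2} {d : ℝ} {e : Edge 1 2} :
    (machineMETA M c).Step s d e s' ↔ (machineMETA M c).IsState s ∧ 0 ≤ d ∧
      e ∈ (machineMETA M c).edges ∧ s.loc = e.src ∧
      e.guard.Sat (fun x => s.clock x + d) s.energy ∧ s'.loc = e.tgt ∧
      (∀ x, s'.clock x = s.clock x + d) ∧ (∀ η, s'.energy η = s.energy η + (e.update η : ℝ)) ∧
      ∀ η, 0 ≤ s'.energy η := by
  have hel (b b' : Bool) (t : ℝ) : s.elapse (plainLoc b b').rate t =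
      ⟨s.loc, fun x => s.clock x + t, s.energy⟩ := by
    simp [Config.elapse, plainLoc]
  constructor
  · rintro ⟨_, ⟨hd, L, hL, rfl, hdelay⟩, he, -, hs', hsrc, htgt, hg, hclock, henergy⟩
    have hs := hdelay 0 ⟨le_rfl, hd⟩
    rw [(getElem?_machineLocs.1 hL).2] at hs hsrc hg hclock henergy
    rw [hel] at hs hsrc hg hclock henergy
    refine ⟨by simpa using hs, hd, he, hsrc, hg, htgt, fun x => ?_, henergy, hs'.2.1⟩
    simpa [(src_tgt_machineMETA M c he).2.2.2.2 x] using hclock x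
  · rintro ⟨hs, hd, he, hsrc, hg, htgt, hclock, henergy, hnonneg⟩
    have hs₀ := (isState_machineMETA M c).1 hs
    have hst (t : ℝ) (ht : 0 ≤ t) :
        (machineMETA M c).IsState ⟨s.loc, fun x => s.clock x + t, s.energy⟩ := by
      rw [isState_machineMETA]
      exact ⟨fun x => add_nonneg (hs₀.1 x) ht, hs₀.2⟩
    refine ⟨⟨s.loc, fun x => s.clock x + d, s.energy⟩,
      ⟨hd, _, getElem?_machineLocs.2 ⟨hs₀.2.2, rfl⟩, ?_, fun t ht => ?_⟩, he, hst d hd, ?_, hsrc,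
      htgt, hg, fun x => ?_, henergy⟩
    · rw [hel]
    · rw [hel]
      exact hst t ht.1
    · rw [isState_machineMETA, htgt]
      refine ⟨fun x => ?_, hnonneg, (src_tgt_machineMETA M c he).2.1⟩
      rw [hclock]
      exact add_nonneg (hs₀.1 x) hd
    · simp [(src_tgt_machineMETA M c he).2.2.2.2 x, hclock]

/-- Paths that end in the final location end there with clock value `1` and energies `0`. -/
theorem pathEnd_machineMETA {s : Config 1 2} {ρ : List (RunStep 1 2)}
    (h : (machineMETA M c).IsPath s ρ) (hs : s.loc ≠ 2) (hend : (pathEnd s ρ).loc = 2) :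
    s.clock 0 + duration ρ = 1 ∧ (pathEnd s ρ).energy = 0 := by
  induction h with
  | nil _ => exact absurd hend hs
  | @cons s d e s' ρ hstep hpath ih =>
    obtain ⟨hst, hd, he, hsrc, hg, htgt, hclock, henergy, -⟩ := (step_machineMETA M c).1 hstep
    rw [pathEnd_cons] at hend ⊢
    have hdur : duration (⟨d, e, s'⟩ :: ρ) = d + duration ρ := by simp [duration]
    -- As there are no resets, the clock value plus the remaining duration is constant along the
    -- path.
    rw [hdur, ← add_assoc, ← hclock 0]
    by_cases hs' : s'.loc = 2
    · cases hpath with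
      | nil _ =>
        -- Only exit edges lead to location `2`; all others have target `1` or at least `3`.
        have hexit : e.guard = exitGuard ∧ e.update = 0 := by
          rw [hs'] at htgt
          obtain rfl | rfl | rfl | ⟨q, a, rfl⟩ | ⟨q, _, rfl⟩ :=
            (mem_edges_machineMETA M c).1 he
          · simp only [plainEdge] at htgt; omega
          · simp [plainEdge] at htgt
          · exact ⟨rfl, rfl⟩
          · simp only [plainEdge] at htgt; omega
          · exact ⟨rfl, rfl⟩
        rw [hexit.1, exitGuard_sat_iff ((isState_machineMETA M c).1 hst).2.1] at hg
        refine ⟨by simp [duration, hclock, hg.1], ?_⟩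
        ext η
        simp [pathEnd_nil, henergy, hexit.2, hg.2]
      | cons hstep' _ =>
        obtain ⟨-, -, he', hsrc', -⟩ := (step_machineMETA M c).1 hstep'
        exact absurd (hsrc'.symm.trans hs') (src_tgt_machineMETA M c he').2.2.1
    · exact ih hs' hend

theorem DEO_machineMETA {ρ : List (RunStep 1 2)} (h : (machineMETA M c).IsRun ρ)
    (hend : (machineMETA M c).IsFinal ((machineMETA M c).lastState ρ).loc) :
    (machineMETA M c).DEO ρ = [0] := by
  rw [isFinal_machineMETA] at hend
  obtain ⟨hdur, hen⟩ := pathEnd_machineMETA M c h (by simp [initState, machineMETA]) hend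
  rw [DEO_of_duration_eq_one _ (by simpa [initState] using hdur)]
  exact congrArg (fun v => [v]) hen

theorem exists_privateRun_machineMETA : ∃ ρ, (machineMETA M c).IsPrivateRun ρ := by
  have hinit : (machineMETA M c).initState = ⟨0, fun _ => 0, fun _ => 0⟩ := rfl
  refine ⟨[⟨0, plainEdge 0 [] 0 1, ⟨1, fun _ => 0, fun _ => 0⟩⟩,
    ⟨1, plainEdge 1 exitGuard 0 2, ⟨2, fun _ => 1, fun _ => 0⟩⟩], ?_, ?_, ?_⟩
  · refine .cons ((step_machineMETA M c).2 ?_) (.cons ((step_machineMETA M c).2 ?_) (.nil ?_))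
    · rw [hinit, isState_machineMETA, mem_edges_machineMETA]
      refine ⟨⟨fun _ => le_rfl, fun _ => le_rfl, ?_⟩, le_rfl, .inr (.inl rfl), rfl, ?_, rfl, ?_, ?_,
        fun _ => le_rfl⟩
      · dsimp only; omega
      · simp [plainEdge, SimpleConstraint.Sat]
      · simp
      · simp [plainEdge]
    · rw [isState_machineMETA, mem_edges_machineMETA]
      refine ⟨⟨fun _ => le_rfl, fun _ => le_rfl, ?_⟩, zero_le_one, .inr (.inr (.inl rfl)), rfl, ?_,
        rfl, ?_, ?_, fun _ => le_rfl⟩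
      · dsimp only; omega
      · refine (exitGuard_sat_iff fun _ => le_rfl).2 ⟨by simp, rfl⟩
      · simp
      · simp [plainEdge]
    · rw [isState_machineMETA]
      refine ⟨fun _ => zero_le_one, fun _ => le_rfl, ?_⟩
      dsimp only; omega
  · rw [isFinal_machineMETA]
    rfl
  · refine ⟨⟨1, fun _ => 0, fun _ => 0⟩, by simp [states], ?_⟩
    rw [isPriv_machineMETA]

/-- The instructions are executed with delay `0`, and the whole time unit elapses just before the
exit. -/
theorem exists_path_of_exec {w : List (RegOp (Fin 2))} {τ : Fin 2 →₀ ℕ} {q : Fin N}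
    (hw : RegOp.Exec w τ 0) (hq : M.evalFrom q w ∈ M.accept) :
    ∃ ρ, (machineMETA M c).IsPath ⟨3 + q, fun _ => 0, fun i => (τ i : ℝ)⟩ ρ ∧
      (pathEnd ⟨3 + q, fun _ => 0, fun i => (τ i : ℝ)⟩ ρ).loc = 2 ∧
      ∀ s ∈ ρ.map RunStep.target, s.loc ≠ 1 := by
  have hstate (τ : Fin 2 →₀ ℕ) (q : Fin N) :
      (machineMETA M c).IsState ⟨3 + q, fun _ => 0, fun i => (τ i : ℝ)⟩ := by
    rw [isState_machineMETA]
    refine ⟨fun _ => le_rfl, fun _ => Nat.cast_nonneg _, ?_⟩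
    dsimp only; omega
  induction w generalizing τ q with
  | nil =>
    obtain rfl : 0 = τ := hw
    refine ⟨[⟨1, plainEdge (3 + q) exitGuard 0 2, ⟨2, fun _ => 1, fun _ => 0⟩⟩],
      .cons ((step_machineMETA M c).2 ?_) (.nil ?_), rfl, by simp⟩
    · rw [mem_edges_machineMETA]
      refine ⟨hstate 0 q, zero_le_one, .inr (.inr (.inr (.inr ⟨q, hq, rfl⟩))), rfl, ?_, rfl, ?_,
        ?_, fun _ => le_rfl⟩
      · refine (exitGuard_sat_iff fun _ => by simp).2 ⟨by simp, ?_⟩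
        ext
        simp
      · simp
      · simp [plainEdge]
    · rw [isState_machineMETA]
      refine ⟨fun _ => zero_le_one, fun _ => le_rfl, ?_⟩
      dsimp only; omega
  | cons a w ih =>
    obtain ⟨τ', hrel, hw⟩ := hw
    obtain ⟨ρ, hρ, hend, hpub⟩ := ih (q := M.step q a) hw (by simpa using hq)
    obtain ⟨hg, hup⟩ := (a.rel_iff (fun _ => 0) τ τ').1 hrel
    refine ⟨⟨0, plainEdge (3 + q) a.guard a.update (3 + M.step q a),
      ⟨3 + M.step q a, fun _ => 0, fun i => (τ' i : ℝ)⟩⟩ :: ρ,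
      .cons ((step_machineMETA M c).2 ?_) hρ, by rwa [pathEnd_cons], ?_⟩
    · rw [mem_edges_machineMETA]
      exact ⟨hstate τ q, le_rfl, .inr (.inr (.inr (.inl ⟨q, a, rfl⟩))), rfl,
        by simpa [plainEdge] using hg, rfl, by simp, hup, fun _ => Nat.cast_nonneg _⟩
    · rw [List.map_cons, List.forall_mem_cons]
      refine ⟨?_, hpub⟩
      dsimp only; omega

/-- Delays are irrelevant here, since the guards of instructions do not mention the clock. Edges out
of the machine states lead to machine states or to the exit. -/
theorem exists_exec_of_path {s : Config 1 2} {ρ : List (RunStep 1 2)}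
    (h : (machineMETA M c).IsPath s ρ) (hend : (pathEnd s ρ).loc = 2) {τ : Fin 2 →₀ ℕ} {q : Fin N}
    (hs : s.loc = 3 + q) (hτ : ∀ i, s.energy i = τ i) :
    ∃ w, RegOp.Exec w τ 0 ∧ M.evalFrom q w ∈ M.accept := by
  induction h generalizing τ q with
  | nil _ => rw [pathEnd_nil] at hend; omega
  | @cons s d e s' ρ hstep hpath ih =>
    obtain ⟨hst, -, he, hsrc, hg, htgt, -, henergy, hnonneg⟩ := (step_machineMETA M c).1 hstep
    rw [pathEnd_cons] at hend
    rw [hs] at hsrc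
    obtain rfl | rfl | rfl | ⟨q', a, rfl⟩ | ⟨q', hq', rfl⟩ := (mem_edges_machineMETA M c).1 he
    · simp only [plainEdge] at hsrc; omega
    · simp only [plainEdge] at hsrc; omega
    · simp only [plainEdge] at hsrc; omega
    · obtain rfl : q = q' := by simp only [plainEdge] at hsrc; omega
      -- Offsets are integers and states have nonnegative energies, so the energies remain natural
      -- numbers and are again register contents.
      have hnat (i : Fin 2) : ∃ k : ℕ, s'.energy i = k := by
        have hi : s'.energy i = ((τ i + a.update i : ℤ) : ℝ) := by
          rw [henergy, hτ]
          simp [plainEdge]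
        have h0 := hnonneg i
        rw [hi] at h0 ⊢
        obtain ⟨k, hk⟩ := Int.eq_ofNat_of_zero_le (Int.cast_nonneg_iff.1 h0)
        exact ⟨k, by rw [hk]; simp⟩
      choose f hf using hnat
      obtain ⟨w, hw, hacc⟩ := ih hend (τ := Finsupp.equivFunOnFinite.symm f) htgt
        (fun i => by simp [hf])
      refine ⟨a :: w, ⟨_, (a.rel_iff (fun x => s.clock x + d) _ _).2 ⟨?_, fun i => ?_⟩, hw⟩,
        by simpa using hacc⟩
      · simp only [← hτ]
        exact hg
      · rw [← hτ]
        exact (hf i).symm.trans (henergy i)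
    · obtain rfl : q = q' := by simp only [plainEdge] at hsrc; omega
      have hg := ((exitGuard_sat_iff ((isState_machineMETA M c).1 hst).2.1).1 hg).2
      refine ⟨[], ?_, hq'⟩
      refine Finsupp.ext fun i => ?_
      have := hτ i
      rw [hg] at this
      exact (by simpa using this.symm : τ i = 0).symm

/-- A public run cannot take the initial edge to the private location, so it starts by loading `c`
and then runs the machine. -/
theorem exists_publicRun_machineMETA_iff : (∃ ρ, (machineMETA M c).IsPublicRun ρ) ↔
    ∃ w ∈ M.accepts, RegOp.Exec w (Finsupp.single 0 c) 0 := by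
  have hinit : (machineMETA M c).initState = ⟨0, fun _ => 0, fun _ => 0⟩ := rfl
  constructor
  · rintro ⟨ρ, hρ, hend, hpub⟩
    rw [isFinal_machineMETA] at hend
    simp only [isPriv_machineMETA] at hpub
    cases hρ with
    | nil _ => simp [lastState, states, hinit] at hend
    | @cons _ d e s' ρ hstep hpath =>
      obtain ⟨-, -, he, hsrc, -, htgt, -, henergy, -⟩ := (step_machineMETA M c).1 hstep
      rw [hinit] at hsrc henergy
      change (pathEnd _ _).loc = 2 at hend
      rw [pathEnd_cons] at hend
      obtain rfl | rfl | rfl | ⟨q', a, rfl⟩ | ⟨q', hq', rfl⟩ := (mem_edges_machineMETA M c).1 he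
      · obtain ⟨w, hw, hacc⟩ := exists_exec_of_path M c hpath hend
          (τ := Finsupp.single 0 c) htgt fun i => by
            rw [henergy]
            fin_cases i <;> simp [plainEdge]
        exact ⟨w, hacc, hw⟩
      · exact absurd htgt (hpub s' (by simp [states]))
      · simp [plainEdge] at hsrc
      · simp only [plainEdge] at hsrc; omega
      · simp only [plainEdge] at hsrc; omega
  · rintro ⟨w, hw, hexec⟩
    obtain ⟨ρ, hρ, hend, hpub⟩ := exists_path_of_exec M c (q := M.start) hexec hw
    refine ⟨⟨0, plainEdge 0 [] (fun i => if i = 0 then (c : ℤ) else 0) (3 + M.start), _⟩ :: ρ,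
      .cons ((step_machineMETA M c).2 ?_) hρ, ?_, ?_⟩
    · rw [hinit, isState_machineMETA, mem_edges_machineMETA]
      refine ⟨⟨fun _ => le_rfl, fun _ => le_rfl, ?_⟩, le_rfl, .inl rfl, rfl, ?_, rfl, by simp,
        fun i => ?_, fun _ => Nat.cast_nonneg _⟩
      · dsimp only; omega
      · simp [plainEdge, SimpleConstraint.Sat]
      · fin_cases i <;> simp [plainEdge]
    · rw [isFinal_machineMETA]
      change (pathEnd _ _).loc = 2
      rwa [pathEnd_cons]
    · simp only [isPriv_machineMETA, states, List.map_cons, List.forall_mem_cons]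
      refine ⟨by simp [hinit], by omega, hpub⟩

/-- Since the final location is reached with a fixed observation, and a private run exists, all
variants of opacity amount to the existence of a public run. -/
theorem deOpaque_machineMETA_iff (δ : OpacityKind) : (machineMETA M c).DEOpaque δ ↔
    ∃ w ∈ M.accepts, RegOp.Exec w (Finsupp.single 0 c) 0 := by
  rw [← exists_publicRun_machineMETA_iff]
  obtain ⟨ρ₀, h₀⟩ := exists_privateRun_machineMETA M c
  have hpriv {ρ} (h : (machineMETA M c).IsPrivateRun ρ) := DEO_machineMETA M c h.1 h.2.1
  have hpubl {ρ} (h : (machineMETA M c).IsPublicRun ρ) := DEO_machineMETA M c h.1 h.2.1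
  cases δ with
  | exist =>
    exact ⟨fun ⟨_, ρ', _, h, _⟩ => ⟨ρ', h⟩,
      fun ⟨ρ', h⟩ => ⟨ρ₀, ρ', h₀, h, (hpriv h₀).trans (hpubl h).symm⟩⟩
  | weak =>
    exact ⟨fun h => let ⟨ρ', h', _⟩ := h ρ₀ h₀; ⟨ρ', h'⟩,
      fun ⟨ρ', h'⟩ ρ h => ⟨ρ', h', (hpriv h).trans (hpubl h').symm⟩⟩
  | full =>
    exact ⟨fun h => let ⟨ρ', h', _⟩ := h.1 ρ₀ h₀; ⟨ρ', h'⟩,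
      fun ⟨ρ', h'⟩ => ⟨fun ρ h => ⟨ρ', h', (hpriv h).trans (hpubl h').symm⟩,
        fun ρ h => ⟨ρ₀, h₀, (hpriv h₀).trans (hpubl h).symm⟩⟩⟩

end GuardedMETA

/-! ### Undecidability -/

theorem Primrec.int_natCast : Primrec fun n : ℕ => (n : ℤ) := by
  -- The encoding of `ℤ` sends a nonnegative `n` to `2 * n`.
  refine Primrec.encode_iff.1 ((Primrec.nat_double).of_eq fun n => ?_)
  rfl

theorem Primrec.two_pow : Primrec fun n : ℕ => 2 ^ n :=
  (Primrec.nat_rec₁ 1 (Primrec.nat_double.comp Primrec.snd).to₂).of_eq fun n => by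
    induction n with
    | zero => rfl
    | succ n ih => rw [pow_succ, ← ih, mul_comm]

/-- As `M` is fixed, its edges, although listed by choice, form a constant; only one offset varies
with the input. -/
theorem GuardedMETA.primrec_machineMETA {N : ℕ} (M : DFA (RegOp (Fin 2)) (Fin N)) :
    Primrec (machineMETA M) := by
  have hupdate : Primrec fun (c : ℕ) (i : Fin 2) => if i = 0 then (c : ℤ) else 0 :=
    Primrec.fin_curry.2 (Primrec.ite (Primrec.eq.comp Primrec.snd (Primrec.const 0))
      (Primrec.int_natCast.comp Primrec.fst) (Primrec.const 0))
  have hedge : Primrec fun c : ℕ =>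
      plainEdge 0 [] (fun i => if i = 0 then (c : ℤ) else 0) (3 + M.start) :=
    (Primrec.of_equiv_iff (Edge.equivProd 1 2)).1
      ((Primrec.const 0).pair ((Primrec.const []).pair ((Primrec.const none).pair
        ((Primrec.const fun _ => false).pair (hupdate.pair (Primrec.const _))))))
  exact (Primrec.of_equiv_iff (GuardedMETA.equivProd 1 2)).1
    ((Primrec.const 0).pair ((Primrec.const 0).pair ((Primrec.const _).pair
      ((Primrec.const 0).pair (Primrec.list_cons.comp hedge (Primrec.const _))))))

/-- Undecidable problems do not reduce to decidable ones. -/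
theorem DecidableOn.computablePred {α β : Type} [Primcodable α] [Primcodable β] {C : Set α}
    {P : α → Prop} (h : DecidableOn C P) {g : β → α} (hg : Computable g) (hC : ∀ b, g b ∈ C) :
    ComputablePred fun b => P (g b) := by
  classical
  obtain ⟨f, hf, hfP⟩ := h
  refine ⟨inferInstance, (hf.comp hg).of_eq fun b => ?_⟩
  obtain ⟨r, hr, hrP⟩ := hfP (g b) (hC b)
  rw [Part.eq_some_iff.2 hr]
  cases r <;> simp_all

open Nat.Partrec in
/-- The halting problem is the projection of a primitive recursive relation. -/
theorem exists_primrec₂_halting : ∃ p : ℕ → ℕ → ℕ, Primrec₂ p ∧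
    ∀ c : Code, (∃ k, p (Encodable.encode c) k = 0) ↔ (c.eval 0).Dom := by
  refine ⟨fun n k => if (Code.evaln k (Denumerable.ofNat Code n) 0).isSome then 0 else 1,
    Primrec.ite (Primrec.eq.comp (Primrec.option_isSome.comp (Code.primrec_evaln.comp
      ((Primrec.snd.pair ((Primrec.ofNat Code).comp Primrec.fst)).pair (Primrec.const 0))))
      (Primrec.const true)) (Primrec.const 0) (Primrec.const 1), fun c => ?_⟩
  simp only [Denumerable.ofNat_encode, Part.dom_iff_mem, Code.evaln_complete,
    Option.mem_def]
  rw [exists_comm]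
  refine exists_congr fun k => ?_
  rw [← Option.isSome_iff_exists]
  split_ifs with h <;> simp [h]

theorem mainTheorem7 (δ : OpacityKind) :
    ¬ DecidableOn {A : GuardedMETA 1 2 | A.WellFormed ∧ A.IsDiscrete}
      (fun A => A.DEOpaque δ) := by
  intro h
  obtain ⟨p, hp, hhalt⟩ := exists_primrec₂_halting
  obtain ⟨N, M, hM⟩ := RegProg.exists_dfa hp
  -- The two-register machine reads its input `n` as `2 ^ n`, the Gödel number of `n` in register
  -- `0`.
  refine ComputablePred.halting_problem 0 ((h.computablePred
    (g := fun c : Nat.Partrec.Code => GuardedMETA.machineMETA M (2 ^ Encodable.encode c))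
    (((GuardedMETA.primrec_machineMETA M).comp
      (Primrec.two_pow.comp Primrec.encode)).to_comp) fun c =>
      ⟨GuardedMETA.wellFormed_machineMETA M _, GuardedMETA.isDiscrete_machineMETA M _⟩).of_eq
    fun c => ?_)
  rw [GuardedMETA.deOpaque_machineMETA_iff, hM, hhalt]
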